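/- For a finite sequence $(k_1,\dots,k_r)$, $r\ge 1$, of integers with $k_1\ge 2$ and $k_2,\dots,k_r\ge 1$, let $$\zeta^\star(k_1,\dots,k_r)=\sum_{n_1\ge\cdots\ge n_r\ge 1}\frac{1}{n_1^{k_1}\cdots n_r^{k_r}} .$$ Let $\mathcal S$ be the set of these finite sequences and $\mathcal Z^\star=\zeta^\star(\mathcal S)$ the set of multiple zeta-star values. On $\mathcal S$ write $\mathbf k\succ\mathbf m$ if $\mathbf k$ is a proper prolongation of $\mathbf m$, or if for some $j\ge 0$ (smaller than both lengths) $k_i=m_i$ for $1\le i\le j$ and $k_{j+1}<m_{j+1}$. Let $\mathcal T$ be the set of infinite sequences $\mathbf k=(k_1,k_2,\dots)$ of integers with $k_1\ge 2$, $k_i\ge 1$ for $i\ge 2$, and, in case $k_1=2$, $k_s\ge 2$ for some $s\ge 2$. For $\mathbf k,\mathbf m\in\mathcal T$ write $\mathbf k\succ\mathbf m$ if for some $j\ge 0$ one has $k_i=m_i$ for $1\le i\le j$ and $k_{j+1}<m_{j+1}$. **Theorem 1.3.** (i) For every $\mathbf k\in\mathcal T$ the limit $\eta(\mathbf k)=\lim_{r\to\infty}\zeta^\star(k_1,\dots,k_r)$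 exists and $\eta(\mathbf k)>1$. (ii) The map $\eta:\mathcal T\to(1,+\infty)$ is bijective. The relation $\succ$ on $\mathcal T$ is a strict total order, and it is the unique strict order on $\mathcal T$ that extends the order of $\mathcal S$, in the sense that $\mathbf k\succ\mathbf m$ whenever $(k_1,\dots,k_r)\succ(m_1,\dots,m_r)$ in $\mathcal S$ for some $r\ge 1$. For all $\mathbf k,\mathbf m\in\mathcal T$, $\mathbf k\succ\mathbf m$ if and only if $\eta(\mathbf k)>\eta(\mathbf m)$. (iii) For a set $C$ let $C^{(1)}$ be the set of its accumulation points, and $C^{(n+1)}=(C^{(n)})^{(1)}$. Then for every $n\ge 1$, $(\mathcal Z^\star)^{(n)}=[1,+\infty]$ when accumulation points are taken in the extended real line $[-\infty,+\infty]$, and $(\mathcal Z^\star)^{(n)}=[1,+\infty)$ when they are taken in $\mathbb R$. In particular $\mathcal Z^\star$ is a dense subset of $(1,+\infty)$. -/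

import Mathlib

open Filter Topology

namespace ZetaStar

/-- The multiple zeta-star series
`ζ⋆(k₁, …, k_r) = ∑_{n₁ ≥ ⋯ ≥ n_r ≥ 1} 1 / (n₁ ^ k₁ ⋯ n_r ^ k_r)`, where `k = [k₁, …, k_r]`.
The sum runs over all weakly decreasing tuples of positive integers. -/
noncomputable def zetaStar (k : List ℕ) : ℝ :=
  ∑' n : {n : Fin k.length → ℕ+ // Antitone n},
    ∏ i : Fin k.length, 1 / (((n.1 i : ℕ) : ℝ) ^ k.get i)

/-- The set `𝒮` of finite sequences `(k₁, …, k_r)`, `r ≥ 1`, with `k₁ ≥ 2` and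
`k₂, …, k_r ≥ 1`. -/
def S : Set (List ℕ) :=
  {k | ∃ (a : ℕ) (l : List ℕ), k = a :: l ∧ 2 ≤ a ∧ ∀ b ∈ l, 1 ≤ b}

/-- The set `𝒵⋆` of multiple zeta-star values. -/
def Z : Set ℝ := zetaStar '' S

/-- The order `≻` on finite sequences: `k ≻ m` if `k` is a proper prolongation of `m`, or if
`k` and `m` agree before some position, and `k` has the smaller entry at that position. -/
def SGt (k m : List ℕ) : Prop :=
  (∃ l : List ℕ, l ≠ [] ∧ k = m ++ l) ∨
    ∃ (p : List ℕ) (a b : ℕ) (k' m' : List ℕ), k = p ++ a :: k' ∧ m = p ++ b :: m' ∧ a < b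

/-- The set `𝒯` of infinite sequences `(k₁, k₂, …)` with `k₁ ≥ 2`, all `k_i ≥ 1`, and, if
`k₁ = 2`, with `k_s ≥ 2` for some `s ≥ 2`. The entry `k_{i+1}` is `k i`. -/
def T : Set (ℕ → ℕ) :=
  {k | 2 ≤ k 0 ∧ (∀ i, 1 ≤ k i) ∧ (k 0 = 2 → ∃ s, 1 ≤ s ∧ 2 ≤ k s)}

/-- The truncation `(k₁, …, k_r)` of an infinite sequence. -/
def trunc (k : ℕ → ℕ) (r : ℕ) : List ℕ := List.ofFn fun i : Fin r => k i

/-- The order `≻` on `𝒯`: `k ≻ m` if at the first position where they differ the entry of `k`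
is smaller. -/
def TGt (k m : T) : Prop := ∃ j : ℕ, (∀ i < j, k.1 i = m.1 i) ∧ k.1 j < m.1 j

/-- A relation on `𝒯` extends the order of `𝒮` if it holds between two infinite sequences as soon
as the order of `𝒮` holds between their truncations to some common length `r ≥ 1`. -/
def ExtendsSGt (R : T → T → Prop) : Prop :=
  ∀ (k m : T) (r : ℕ), 1 ≤ r → SGt (trunc k.1 r) (trunc m.1 r) → R k m

end ZetaStar

namespace ZetaStar

/-! With innermost weight `one` the nested sums are the partial sums of ζ⋆. The weight `succ` (n +
1) is fixed by a further entry 1 and not increased by any entry ≥ 1. Hence all prolongations of `l`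
by entries ≥ 1 have values between `nestedSup l one` and `nestedSup l succ`, the ends of the
cylinder of `l` (open below, closed above).

Since (n + 1) / (n + 1)^(k+1) = 1 / (n + 1)^k, the upper end for `l ++ [k + 1]` is the lower end for
`l ++ [k]`. The upper end for `l ++ [1]` is that of `l`, and the lower ends for `l ++ [k]` tend to
that of `l`, if finite, as k grows. So the cylinders of the `l ++ [k]` tile that of `l`, larger k
lying lower. This makes η strictly monotone (`eta_lt_eta`), and a greedy choice of entries attaches
a sequence to every x > 1 (`exists_greedy`).

Its value is x because cylinders shrink: with all indices bounded by N, the two ends of a cylinder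
of length r differ by at most (N/(N+1))^r N, and the tails beyond N are dominated uniformly in r
(`le_of_le_nestedSup_succ`). As every number above 1 is then a limit of ζ⋆ values, the set of these
is order-dense in the ray, which gives all derived sets. -/

/-! ### Nested sums as monotone linear operators -/

/-- The nested sum `∑ g m_r / ((m₁ + 1) ^ k₁ ⋯ (m_r + 1) ^ k_r)` over `n ≥ m₁ ≥ ⋯ ≥ m_r ≥ 0`. -/
noncomputable def nested : List ℕ → (ℕ → ℝ) → ℕ → ℝ
  | [], g => g
  | k :: l, g => fun n => ∑ m ∈ Finset.range (n + 1), nested l g m / ((m : ℝ) + 1) ^ k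

theorem nested_nil (g : ℕ → ℝ) : nested [] g = g := rfl

theorem nested_cons (k : ℕ) (l : List ℕ) (g : ℕ → ℝ) (n : ℕ) :
    nested (k :: l) g n = ∑ m ∈ Finset.range (n + 1), nested l g m / ((m : ℝ) + 1) ^ k := rfl

theorem nested_append (l l' : List ℕ) (g : ℕ → ℝ) :
    nested (l ++ l') g = nested l (nested l' g) := by
  induction l with
  | nil => rfl
  | cons k l ih => funext n; simp only [List.cons_append, nested_cons, ih]

theorem nested_mono (l : List ℕ) {g h : ℕ → ℝ} (hgh : ∀ n, g n ≤ h n) (n : ℕ) :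
    nested l g n ≤ nested l h n := by
  induction l generalizing n with
  | nil => exact hgh n
  | cons k l ih =>
    simp only [nested_cons]
    gcongr
    exact ih _

theorem nested_nonneg (l : List ℕ) {g : ℕ → ℝ} (hg : ∀ n, 0 ≤ g n) (n : ℕ) :
    0 ≤ nested l g n := by
  induction l generalizing n with
  | nil => exact hg n
  | cons k l ih =>
    exact Finset.sum_nonneg fun m _ => div_nonneg (ih m) (by positivity)

theorem monotone_nested (l : List ℕ) {g : ℕ → ℝ} (hg : ∀ n, 0 ≤ g n) (hm : Monotone g) :
    Monotone (nested l g) := by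
  cases l with
  | nil => exact hm
  | cons k l =>
    intro a b hab
    simp only [nested_cons]
    refine Finset.sum_le_sum_of_subset_of_nonneg (Finset.range_mono (by omega)) fun m _ _ => ?_
    exact div_nonneg (nested_nonneg l hg m) (by positivity)

theorem nested_add (l : List ℕ) (g h : ℕ → ℝ) (n : ℕ) :
    nested l (fun m => g m + h m) n = nested l g n + nested l h n := by
  induction l generalizing n with
  | nil => rfl
  | cons k l ih => simp only [nested_cons, ih, add_div, Finset.sum_add_distrib]

theorem nested_const_mul (l : List ℕ) (c : ℝ) (g : ℕ → ℝ) (n : ℕ) :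
    nested l (fun m => c * g m) n = c * nested l g n := by
  induction l generalizing n with
  | nil => rfl
  | cons k l ih => simp only [nested_cons, ih, mul_div_assoc, Finset.mul_sum]

/-! ### The weights `one` and `succ` -/

/-- The constant function `1`. -/
def one : ℕ → ℝ := fun _ => 1

/-- The function `n ↦ n + 1`. -/
def succ : ℕ → ℝ := fun n => n + 1

theorem one_nonneg (n : ℕ) : 0 ≤ one n := zero_le_one

theorem succ_nonneg (n : ℕ) : 0 ≤ succ n := by unfold succ; positivity

theorem monotone_one : Monotone one := monotone_const

theorem monotone_succ : Monotone succ := fun a b h => by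
  unfold succ; gcongr

theorem one_le_succ (n : ℕ) : one n ≤ succ n := by simp [one, succ]

theorem one_le_nested (l : List ℕ) (n : ℕ) : 1 ≤ nested l one n := by
  induction l generalizing n with
  | nil => exact le_rfl
  | cons k l ih =>
    rw [nested_cons]
    calc (1 : ℝ) ≤ nested l one 0 / (((0 : ℕ) : ℝ) + 1) ^ k := by simpa using ih 0
      _ ≤ _ := Finset.single_le_sum
          (f := fun m : ℕ => nested l one m / ((m : ℝ) + 1) ^ k)
          (fun m _ => div_nonneg (nested_nonneg l one_nonneg m) (by positivity)) (by simp)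

theorem nested_one_le_append (l l' : List ℕ) (n : ℕ) :
    nested l one n ≤ nested (l ++ l') one n := by
  rw [nested_append]
  exact nested_mono l (one_le_nested l') n

theorem nested_singleton_one_succ (n : ℕ) : nested [1] succ n = succ n := by
  simp only [nested_cons, nested_nil, succ, pow_one]
  rw [Finset.sum_congr rfl fun m _ => div_self (by positivity)]
  simp

theorem nested_singleton_succ_le {k : ℕ} (hk : 1 ≤ k) (n : ℕ) :
    nested [k] succ n ≤ succ n := by
  rw [← nested_singleton_one_succ n]
  simp only [nested_cons, nested_nil]
  refine Finset.sum_le_sum fun m _ => ?_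
  exact div_le_div_of_nonneg_left (succ_nonneg m) (by positivity)
    (pow_le_pow_right₀ (by simp) hk)

theorem nested_succ_le {l : List ℕ} (hl : ∀ b ∈ l, 1 ≤ b) (n : ℕ) :
    nested l succ n ≤ succ n := by
  induction l generalizing n with
  | nil => exact le_rfl
  | cons k l ih =>
    rw [← List.singleton_append, nested_append]
    exact (nested_mono [k] (ih fun b hb => hl b (List.mem_cons_of_mem _ hb)) n).trans
      (nested_singleton_succ_le (hl k List.mem_cons_self) n)

/-- The weight m + 1 cancels one power; this identity makes neighbouring cylinders share an
endpoint. -/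
theorem nested_singleton_add_one_succ (k : ℕ) : nested [k + 1] succ = nested [k] one := by
  funext n
  simp only [nested_cons, nested_nil, succ, one]
  refine Finset.sum_congr rfl fun m _ => ?_
  have : (m : ℝ) + 1 ≠ 0 := by positivity
  rw [pow_succ]
  field_simp

theorem nested_singleton_one_anti {a b : ℕ} (hab : a ≤ b) (n : ℕ) :
    nested [b] one n ≤ nested [a] one n := by
  simp only [nested_cons, nested_nil]
  refine Finset.sum_le_sum fun m _ => ?_
  exact div_le_div_of_nonneg_left zero_le_one (by positivity)
    (pow_le_pow_right₀ (by simp) hab)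

theorem nested_singleton_add_two_le (j n : ℕ) :
    nested [j + 2] one n ≤ 1 + (1 / 2) ^ j := by
  -- The correction 1/(n + 1) makes the induction telescope, through 1/(n+2)^2 ≤ 1/(n+1) - 1/(n+2).
  have key : nested [j + 2] one n ≤ 1 + (1 / 2) ^ j * (1 - 1 / ((n : ℝ) + 1)) := by
    simp only [nested_cons, nested_nil, one]
    induction n with
    | zero => simp
    | succ n ih =>
      rw [Finset.sum_range_succ]
      have h0 : (0 : ℝ) ≤ n := n.cast_nonneg
      have h1 : 1 / (((n + 1 : ℕ) : ℝ) + 1) ^ (j + 2) ≤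
          (1 / 2) ^ j * (1 / ((n : ℝ) + 1) - 1 / ((n : ℝ) + 2)) := by
        have e : (1 : ℝ) / (((n + 1 : ℕ) : ℝ) + 1) ^ (j + 2) =
            (1 / ((n : ℝ) + 2)) ^ j * (1 / ((n : ℝ) + 2) ^ 2) := by
          push_cast
          rw [pow_add, one_div_pow, ← one_div_mul_one_div]
          ring
        rw [e]
        gcongr
        · linarith
        · rw [div_sub_div _ _ (by positivity) (by positivity), div_le_div_iff₀ (by positivity)
            (by positivity)]
          nlinarith
      calc _ ≤ _ := add_le_add ih h1
        _ = _ := by push_cast; ring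
  refine key.trans ?_
  have : 0 ≤ 1 / ((n : ℝ) + 1) := by positivity
  nlinarith [pow_pos (by norm_num : (0 : ℝ) < 1 / 2) j]

/-! ### Decay of the gap, convergence, and strict growth -/

/-- The weight m is the difference `succ - one`. Each layer costs a factor m/(m+1) ≤ N/(N+1), and
the term m = 0 vanishes. -/
theorem nested_cast_le {l : List ℕ} (hl : ∀ b ∈ l, 1 ≤ b) {n N : ℕ} (hn : n ≤ N) :
    nested l (fun m => (m : ℝ)) n ≤ ((N : ℝ) / (N + 1)) ^ l.length * n := by
  induction l generalizing n with
  | nil => simp [nested_nil]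
  | cons k l ih =>
    have ih' := fun {n : ℕ} (hn : n ≤ N) =>
      ih (fun b hb => hl b (List.mem_cons_of_mem _ hb)) hn
    have hk := hl k List.mem_cons_self
    rw [nested_cons, Finset.sum_range_succ', List.length_cons]
    have h0 : nested l (fun m => (m : ℝ)) 0 ≤ 0 := by simpa using ih' (Nat.zero_le N)
    have h1 : ∀ m ∈ Finset.range n,
        nested l (fun m => (m : ℝ)) (m + 1) / (((m + 1 : ℕ) : ℝ) + 1) ^ k ≤
          ((N : ℝ) / (N + 1)) ^ (l.length + 1) := by
      intro m hm
      have hmN : m + 1 ≤ N := by have := Finset.mem_range.1 hm; omega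
      have hmN' : ((m + 1 : ℕ) : ℝ) ≤ N := by exact_mod_cast hmN
      calc _ ≤ ((N : ℝ) / (N + 1)) ^ l.length * ((m + 1 : ℕ) : ℝ) /
            (((m + 1 : ℕ) : ℝ) + 1) ^ 1 := by
            apply div_le_div₀ (by positivity) (ih' hmN) (by positivity)
            exact pow_le_pow_right₀ (by simp; positivity) hk
        _ ≤ _ := by
            rw [pow_one, pow_succ, mul_div_assoc]
            gcongr ?_ * ?_
            rw [div_le_div_iff₀ (by positivity) (by positivity)]
            nlinarith
    have h2 := Finset.sum_le_card_nsmul _ _ _ h1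
    rw [Finset.card_range, nsmul_eq_mul] at h2
    have h3 : nested l (fun m => (m : ℝ)) 0 / (((0 : ℕ) : ℝ) + 1) ^ k ≤ 0 := by
      simpa using h0
    linarith

theorem nested_succ_le_add {l : List ℕ} (hl : ∀ b ∈ l, 1 ≤ b) (N : ℕ) :
    nested l succ N ≤ nested l one N + ((N : ℝ) / (N + 1)) ^ l.length * N := by
  have : succ = fun m => one m + (m : ℝ) := by
    funext m; simp [succ, one, add_comm]
  rw [this, nested_add]
  gcongr
  exact nested_cast_le hl le_rfl

theorem sum_inv_sqrt_le (n : ℕ) :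
    ∑ m ∈ Finset.range n, √((m : ℝ) + 1) / ((m : ℝ) + 1) ≤ 2 * √(n : ℝ) := by
  induction n with
  | zero => simp
  | succ n ih =>
    rw [Finset.sum_range_succ]
    have hn : (0 : ℝ) ≤ n := n.cast_nonneg
    have ha := Real.sq_sqrt hn
    have hb := Real.sq_sqrt (by positivity : (0 : ℝ) ≤ (n : ℝ) + 1)
    have hb0 : 0 < √((n : ℝ) + 1) := Real.sqrt_pos.2 (by positivity)
    have h : √((n : ℝ) + 1) / ((n : ℝ) + 1) ≤ 2 * √((n : ℝ) + 1) - 2 * √(n : ℝ) := by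
      rw [div_le_iff₀ (by positivity)]
      set a := √(n : ℝ)
      set b := √((n : ℝ) + 1)
      rw [← hb]
      have : b ^ 2 = a ^ 2 + 1 := by linarith
      nlinarith [mul_nonneg hb0.le (sq_nonneg (b - a))]
    push_cast
    linarith

/-- A crude growth bound that suffices for convergence: against a leading exponent ≥ 2 it leaves a
series with exponent 3/2. -/
theorem nested_one_le_sqrt {l : List ℕ} (hl : ∀ b ∈ l, 1 ≤ b) (n : ℕ) :
    nested l one n ≤ 2 ^ l.length * √((n : ℝ) + 1) := by
  induction l generalizing n with
  | nil => simp [nested_nil, one]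
  | cons k l ih =>
    have hk := hl k List.mem_cons_self
    rw [nested_cons, List.length_cons]
    calc _ ≤ ∑ m ∈ Finset.range (n + 1), 2 ^ l.length * (√((m : ℝ) + 1) / ((m : ℝ) + 1)) := by
          refine Finset.sum_le_sum fun m _ => ?_
          rw [← mul_div_assoc]
          apply div_le_div₀ (by positivity) (ih (fun b hb => hl b (List.mem_cons_of_mem _ hb)) m)
            (by positivity)
          exact le_self_pow₀ (by simp) (by omega)
      _ ≤ 2 ^ l.length * (2 * √((n : ℝ) + 1)) := by
          rw [← Finset.mul_sum]
          gcongr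
          simpa using sum_inv_sqrt_le (n + 1)
      _ = _ := by ring

theorem exists_nested_one_le {l : List ℕ} (hl : l ∈ S) : ∃ C, ∀ n, nested l one n ≤ C := by
  obtain ⟨a, l, rfl, ha, hl⟩ := hl
  have hs : Summable fun m : ℕ => (2 : ℝ) ^ l.length * (1 / ((m + 1 : ℕ) : ℝ) ^ (3 / 2 : ℝ)) := by
    refine Summable.mul_left _ ?_
    exact (summable_nat_add_iff 1).2 (Real.summable_one_div_nat_rpow.2 (by norm_num))
  refine ⟨∑' m : ℕ, (2 : ℝ) ^ l.length * (1 / ((m + 1 : ℕ) : ℝ) ^ (3 / 2 : ℝ)), fun n => ?_⟩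
  refine le_trans ?_ (hs.sum_le_tsum (Finset.range (n + 1)) fun m _ => by positivity)
  rw [nested_cons]
  refine Finset.sum_le_sum fun m _ => ?_
  calc _ ≤ 2 ^ l.length * √((m : ℝ) + 1) / ((m : ℝ) + 1) ^ 2 := by
        apply div_le_div₀ (by positivity) (nested_one_le_sqrt hl m) (by positivity)
        exact pow_le_pow_right₀ (by simp) ha
    _ = _ := by
        rw [mul_div_assoc, Real.sqrt_eq_rpow, ← Real.rpow_natCast ((m : ℝ) + 1),
          ← Real.rpow_sub (by positivity), one_div (_ ^ (3 / 2 : ℝ)), ← Real.rpow_neg (by positivity)]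
        norm_num

/-- The gain is uniform in `n`, so it survives the limit as a strict inequality. The bound 0 is
excluded because only the all-ones tuple occurs there and nothing is gained. -/
theorem exists_nested_add_le (l : List ℕ) (k : ℕ) :
    ∃ δ > 0, ∀ n, nested l one (n + 1) + δ ≤ nested (l ++ [k]) one (n + 1) := by
  -- The new layer adds at least (1/2)^k wherever m ≥ 1; the indicator of m ≥ 1 is bounded below by
  -- the single term with all summation indices equal to 1.
  have h : ∃ δ > 0, ∀ n, δ ≤ nested l (fun m => if m = 0 then (0 : ℝ) else 1) (n + 1) := by
    induction l with
    | nil => exact ⟨1, one_pos, fun n => by simp [nested_nil]⟩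
    | cons a l ih =>
      obtain ⟨δ, hδ, h⟩ := ih
      refine ⟨δ / 2 ^ a, by positivity, fun n => ?_⟩
      rw [nested_cons]
      refine le_trans ?_ (Finset.single_le_sum (a := 1)
        (f := fun m : ℕ => nested l (fun m => if m = 0 then (0 : ℝ) else 1) m / ((m : ℝ) + 1) ^ a)
        (fun m _ => div_nonneg (nested_nonneg l (fun m => by split_ifs <;> simp) m)
          (by positivity)) (by simp))
      have := h 0
      rw [zero_add] at this
      have e : ((1 : ℕ) : ℝ) + 1 = 2 := by norm_num
      rw [e]
      gcongr
  obtain ⟨δ, hδ, h⟩ := h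
  refine ⟨(1 / 2) ^ k * δ, by positivity, fun n => ?_⟩
  calc _ ≤ nested l one (n + 1) +
        (1 / 2) ^ k * nested l (fun m => if m = 0 then (0 : ℝ) else 1) (n + 1) := by
        gcongr; exact h n
    _ ≤ _ := by
        rw [← nested_const_mul, ← nested_add, nested_append]
        refine nested_mono l (fun m => ?_) _
        rcases m with _ | m
        · simp [nested_cons, nested_nil, one]
        · simp only [one, nested_cons, nested_nil]
          rw [Finset.sum_range_succ', Finset.sum_range_succ']
          have : 0 ≤ ∑ i ∈ Finset.range m, 1 / (((i + 1 + 1 : ℕ) : ℝ) + 1) ^ k :=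
            Finset.sum_nonneg fun i _ => by positivity
          rw [one_div_pow]
          norm_num at this ⊢
          linarith

/-- The outermost sum over N < m ≤ M has termwise comparable summands, so tails inherit the
comparison of weights. -/
theorem nested_sub_le {k : ℕ} {l : List ℕ} {g h : ℕ → ℝ} (hgh : ∀ n, g n ≤ h n) {N M : ℕ}
    (hNM : N ≤ M) :
    nested (k :: l) g M - nested (k :: l) g N ≤ nested (k :: l) h M - nested (k :: l) h N := by
  simp only [nested_cons]
  rw [← Finset.sum_Ico_eq_sub _ (by omega), ← Finset.sum_Ico_eq_sub _ (by omega)]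
  gcongr
  exact nested_mono l hgh _

/-! ### Ends of cylinders and their tiling -/

/-- The limit of a nested sum as its upper bound tends to infinity. -/
noncomputable def nestedSup (l : List ℕ) (g : ℕ → ℝ) : ENNReal :=
  ⨆ n, ENNReal.ofReal (nested l g n)

theorem ofReal_nested_le (l : List ℕ) (g : ℕ → ℝ) (n : ℕ) :
    ENNReal.ofReal (nested l g n) ≤ nestedSup l g :=
  le_iSup (fun n => ENNReal.ofReal (nested l g n)) n

theorem nestedSup_mono {l l' : List ℕ} {g h : ℕ → ℝ} (H : ∀ n, nested l g n ≤ nested l' h n) :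
    nestedSup l g ≤ nestedSup l' h :=
  iSup_mono fun n => ENNReal.ofReal_le_ofReal (H n)

theorem nestedSup_one_le_succ (l : List ℕ) : nestedSup l one ≤ nestedSup l succ :=
  nestedSup_mono (nested_mono l one_le_succ)

theorem nestedSup_one_le_append (l l' : List ℕ) : nestedSup l one ≤ nestedSup (l ++ l') one :=
  nestedSup_mono (nested_one_le_append l l')

theorem nestedSup_append_succ_le (l : List ℕ) {l' : List ℕ} (hl : ∀ b ∈ l', 1 ≤ b) :
    nestedSup (l ++ l') succ ≤ nestedSup l succ := by
  refine nestedSup_mono fun n => ?_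
  rw [nested_append]
  exact nested_mono l (nested_succ_le hl) n

theorem nestedSup_append_one_succ (l : List ℕ) : nestedSup (l ++ [1]) succ = nestedSup l succ := by
  simp only [nestedSup, nested_append, funext nested_singleton_one_succ]

theorem nestedSup_append_add_one_succ (l : List ℕ) (k : ℕ) :
    nestedSup (l ++ [k + 1]) succ = nestedSup (l ++ [k]) one := by
  simp only [nestedSup, nested_append, nested_singleton_add_one_succ]

theorem nestedSup_succ_le_of_lt (l : List ℕ) {a b : ℕ} (hab : a < b) :
    nestedSup (l ++ [b]) succ ≤ nestedSup (l ++ [a]) one := by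
  obtain ⟨b, rfl⟩ : ∃ c, b = c + 1 := ⟨b - 1, by omega⟩
  rw [nestedSup_append_add_one_succ]
  refine nestedSup_mono fun n => ?_
  rw [nested_append, nested_append]
  exact nested_mono l (nested_singleton_one_anti (by omega)) n

theorem nestedSup_nil_one : nestedSup [] one = 1 := by
  simp [nestedSup, nested_nil, one]

theorem nestedSup_nil_succ : nestedSup [] succ = ⊤ := by
  refine ENNReal.eq_top_of_forall_nnreal_le fun r => ?_
  obtain ⟨n, hn⟩ := exists_nat_ge (r : ℝ)
  refine le_trans ?_ (ofReal_nested_le [] succ n)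
  rw [← ENNReal.ofReal_coe_nnreal]
  apply ENNReal.ofReal_le_ofReal
  simp only [nested_nil, succ]
  linarith

theorem nestedSup_lt_top {l : List ℕ} (hl : l ∈ S) : nestedSup l one < ⊤ := by
  obtain ⟨C, hC⟩ := exists_nested_one_le hl
  exact (iSup_le fun n => ENNReal.ofReal_le_ofReal (hC n)).trans_lt ENNReal.ofReal_lt_top

theorem nestedSup_one_lt_append {l : List ℕ} (hl : nestedSup l one ≠ ⊤) (k : ℕ) :
    nestedSup l one < nestedSup (l ++ [k]) one := by
  obtain ⟨δ, hδ, h⟩ := exists_nested_add_le l k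
  have : nestedSup l one + ENNReal.ofReal δ ≤ nestedSup (l ++ [k]) one := by
    rw [nestedSup, ENNReal.iSup_add]
    refine iSup_le fun n => ?_
    rw [← ENNReal.ofReal_add (nested_nonneg l one_nonneg n) hδ.le]
    refine le_trans (ENNReal.ofReal_le_ofReal ?_) (ofReal_nested_le (l ++ [k]) one (n + 1))
    refine le_trans ?_ (h n)
    gcongr
    exact monotone_nested l one_nonneg monotone_one (Nat.le_succ n)
  exact (ENNReal.lt_add_right hl (by simpa using hδ)).trans_le this

theorem nestedSup_append_add_two_le (l : List ℕ) (j : ℕ) :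
    nestedSup (l ++ [j + 2]) one ≤ ENNReal.ofReal (1 + (1 / 2) ^ j) * nestedSup l one := by
  refine iSup_le fun n => ?_
  calc _ ≤ ENNReal.ofReal ((1 + (1 / 2) ^ j) * nested l one n) := by
        apply ENNReal.ofReal_le_ofReal
        rw [nested_append, ← nested_const_mul]
        exact nested_mono l (fun m => by simpa [one] using nested_singleton_add_two_le j m) n
    _ ≤ _ := by
        rw [ENNReal.ofReal_mul (by positivity)]
        gcongr
        exact ofReal_nested_le l one n

/-- Take the least k whose lower end is below `x`; by minimality `x` is at most the preceding lower
end, which is the upper end for k. -/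
theorem exists_append_interval {l : List ℕ} {x : ENNReal} (hx : nestedSup l one < x)
    (hx' : x ≤ nestedSup l succ) :
    ∃ k, 1 ≤ k ∧ nestedSup (l ++ [k]) one < x ∧ x ≤ nestedSup (l ++ [k]) succ := by
  classical
  have hlim : Tendsto (fun j : ℕ => ENNReal.ofReal (1 + (1 / 2) ^ j) * nestedSup l one) atTop
      (𝓝 (ENNReal.ofReal (1 + 0) * nestedSup l one)) := by
    refine ENNReal.Tendsto.mul_const (ENNReal.tendsto_ofReal ?_) (Or.inr hx.ne_top)
    exact tendsto_const_nhds.add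
      (tendsto_pow_atTop_nhds_zero_of_lt_one (by norm_num) (by norm_num))
  rw [add_zero, ENNReal.ofReal_one, one_mul] at hlim
  obtain ⟨j, hj⟩ := (hlim.eventually_lt_const hx).exists
  have hex : ∃ k, nestedSup (l ++ [k + 1]) one < x :=
    ⟨j + 1, (nestedSup_append_add_two_le l j).trans_lt hj⟩
  refine ⟨Nat.find hex + 1, by omega, Nat.find_spec hex, ?_⟩
  rcases h : Nat.find hex with _ | k
  -- For the entry 1 there is no preceding cylinder; its upper end is that of `l`.
  · rwa [zero_add, nestedSup_append_one_succ]
  · rw [nestedSup_append_add_one_succ]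
    exact not_lt.1 (Nat.find_min hex (by omega : k < Nat.find hex))

/-! ### The zeta-star series as a limit of nested sums -/

/-- The term of the zeta-star series at the tuple `(f 0 + 1, f 1 + 1, …)`. -/
noncomputable def weight (l : List ℕ) (f : Fin l.length → ℕ) : ENNReal :=
  ∏ i, ENNReal.ofReal (1 / ((f i : ℝ) + 1) ^ l.get i)

theorem antitone_cons_iff {r : ℕ} (m : ℕ) (f : Fin r → ℕ) :
    Antitone (Fin.cons m f : Fin (r + 1) → ℕ) ↔ Antitone f ∧ ∀ i, f i ≤ m := by
  constructor
  · intro h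
    refine ⟨fun i j hij => ?_, fun i => ?_⟩
    · simpa using h (Fin.succ_le_succ_iff.2 hij)
    · simpa using h (Fin.zero_le i.succ)
  · rintro ⟨h, hm⟩ i j hij
    induction j using Fin.cases with
    | zero => rw [Fin.le_zero_iff.1 hij]
    | succ j =>
      induction i using Fin.cases with
      | zero => simpa using hm j
      | succ i => simpa using h (Fin.succ_le_succ_iff.1 hij)

theorem weight_cons (a : ℕ) (l : List ℕ) (m : ℕ) (f : Fin l.length → ℕ) :
    weight (a :: l) (Fin.cons m f : Fin (l.length + 1) → ℕ) =
      ENNReal.ofReal (1 / ((m : ℝ) + 1) ^ a) * weight l f := by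
  unfold weight
  exact Fin.prod_univ_succ (n := l.length) _

/-- Splits off the largest index. The set `s` serves both the bounded sums (`Set.Iic N`) and the
full series (`Set.univ`); in `ENNReal` no summability is needed. -/
theorem tsum_weight_cons (a : ℕ) (l : List ℕ) (s : Set ℕ) :
    ∑' f : Fin (l.length + 1) → ℕ, {f | Antitone f ∧ f 0 ∈ s}.indicator (weight (a :: l)) f =
      ∑' m, s.indicator (fun m => ENNReal.ofReal (1 / ((m : ℝ) + 1) ^ a) *
        ∑' f, {f | Antitone f ∧ ∀ i, f i ≤ m}.indicator (weight l) f) m := by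
  rw [← (Fin.consEquiv fun _ => ℕ).tsum_eq, ENNReal.tsum_prod']
  refine tsum_congr fun m => ?_
  by_cases hm : m ∈ s
  · rw [Set.indicator_of_mem hm, ← ENNReal.tsum_mul_left]
    refine tsum_congr fun f => ?_
    by_cases hf : Antitone f ∧ ∀ i, f i ≤ m
    · rw [Set.indicator_of_mem (s := {f | Antitone f ∧ ∀ i, f i ≤ m}) hf, Set.indicator_of_mem]
      · exact weight_cons a l m f
      · exact ⟨(antitone_cons_iff m f).2 hf, hm⟩
    · rw [Set.indicator_of_notMem (s := {f | Antitone f ∧ ∀ i, f i ≤ m}) hf,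
        Set.indicator_of_notMem, mul_zero]
      exact fun h => hf ((antitone_cons_iff m f).1 h.1)
  · rw [Set.indicator_of_notMem hm]
    refine ENNReal.tsum_eq_zero.2 fun f => Set.indicator_of_notMem ?_ _
    exact fun h => hm h.2

theorem tsum_indicator_Iic (u : ℕ → ENNReal) (N : ℕ) :
    ∑' m, (Set.Iic N).indicator u m = ∑ m ∈ Finset.range (N + 1), u m := by
  rw [sum_eq_tsum_indicator]
  refine tsum_congr fun m => ?_
  congr 1
  ext; simp

theorem ofReal_nested_cons (a : ℕ) (l : List ℕ) (n : ℕ) :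
    ENNReal.ofReal (nested (a :: l) one n) = ∑ m ∈ Finset.range (n + 1),
      ENNReal.ofReal (1 / ((m : ℝ) + 1) ^ a) * ENNReal.ofReal (nested l one m) := by
  rw [nested_cons, ENNReal.ofReal_sum_of_nonneg fun m _ =>
    div_nonneg (nested_nonneg l one_nonneg m) (by positivity)]
  refine Finset.sum_congr rfl fun m _ => ?_
  rw [← ENNReal.ofReal_mul (by positivity)]
  congr 1
  ring

theorem tsum_weight_le (l : List ℕ) (N : ℕ) :
    ∑' f, {f | Antitone f ∧ ∀ i, f i ≤ N}.indicator (weight l) f =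
      ENNReal.ofReal (nested l one N) := by
  induction l generalizing N with
  | nil =>
    have : Unique (Fin ([] : List ℕ).length → ℕ) := inferInstanceAs (Unique (Fin 0 → ℕ))
    rw [tsum_fintype, Fintype.sum_unique, Set.indicator_of_mem]
    · simp [weight, nested_nil, one]
    · exact ⟨fun i => i.elim0, fun i => i.elim0⟩
  | cons a l ih =>
    have e : {f : Fin (l.length + 1) → ℕ | Antitone f ∧ ∀ i, f i ≤ N} =
        {f | Antitone f ∧ f 0 ∈ Set.Iic N} := by
      ext f
      exact and_congr_right fun hf => ⟨fun h => h 0, fun h i => (hf (Fin.zero_le i)).trans h⟩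
    refine (tsum_congr fun f => congrArg (fun s => Set.indicator s (weight (a :: l)) f) e).trans
      ((tsum_weight_cons a l (Set.Iic N)).trans ?_)
    rw [tsum_indicator_Iic]
    simp only [ih, ofReal_nested_cons]

theorem tsum_weight_eq_nestedSup (a : ℕ) (l : List ℕ) :
    ∑' f, {f | Antitone f}.indicator (weight (a :: l)) f = nestedSup (a :: l) one := by
  have := tsum_weight_cons a l Set.univ
  simp only [Set.mem_univ, and_true, Set.indicator_univ, tsum_weight_le] at this
  refine this.trans ?_
  rw [ENNReal.tsum_eq_iSup_nat' (tendsto_add_atTop_nat 1)]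
  simp only [nestedSup, ofReal_nested_cons]

/-- Convergence is not needed: for a divergent series both sides take the default value 0. -/
theorem zetaStar_cons (a : ℕ) (l : List ℕ) :
    zetaStar (a :: l) = (nestedSup (a :: l) one).toReal := by
  rw [← tsum_weight_eq_nestedSup]
  have e : ∑' f, {f | Antitone f}.indicator (weight (a :: l)) f =
      ∑' n : {n : Fin (a :: l).length → ℕ+ // Antitone n},
        weight (a :: l) fun i => (n.1 i).natPred := by
    rw [← tsum_subtype]
    let φ : {n : Fin (a :: l).length → ℕ+ // Antitone n} ≃
        {f : Fin (a :: l).length → ℕ | Antitone f} :=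
      (Equiv.arrowCongr (Equiv.refl _) Equiv.pnatEquivNat).subtypeEquiv fun n =>
        ⟨fun h i j hij => PNat.natPred_monotone (h hij),
          fun h i j hij => PNat.natPred_le_natPred.1 (h hij)⟩
    rw [← φ.tsum_eq]
    rfl
  rw [e, ENNReal.tsum_toReal_eq]
  · refine tsum_congr fun n => ?_
    rw [weight, ENNReal.toReal_prod]
    refine Finset.prod_congr rfl fun i _ => ?_
    rw [ENNReal.toReal_ofReal (by positivity)]
    congr 2
    exact_mod_cast (PNat.natPred_add_one _).symm
  · intro n
    exact ENNReal.prod_ne_top fun i _ => ENNReal.ofReal_ne_top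

theorem ofReal_zetaStar {l : List ℕ} (hl : l ∈ S) :
    ENNReal.ofReal (zetaStar l) = nestedSup l one := by
  have h := nestedSup_lt_top hl
  obtain ⟨a, l, rfl, -⟩ := hl
  rw [zetaStar_cons, ENNReal.ofReal_toReal h.ne]

theorem one_lt_nestedSup {l : List ℕ} (hl : l ≠ []) : 1 < nestedSup l one := by
  obtain ⟨a, l, rfl⟩ := List.exists_cons_of_ne_nil hl
  rw [← nestedSup_nil_one]
  refine (nestedSup_one_lt_append (by simp [nestedSup_nil_one]) a).trans_le ?_
  exact nestedSup_one_le_append [a] l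

theorem one_lt_zetaStar {l : List ℕ} (hl : l ∈ S) : 1 < zetaStar l := by
  rw [← ENNReal.ofReal_lt_ofReal_iff_of_nonneg zero_le_one, ofReal_zetaStar hl, ENNReal.ofReal_one]
  obtain ⟨a, l, rfl, -⟩ := hl
  exact one_lt_nestedSup (List.cons_ne_nil a l)

/-! ### Derived sets of order-dense subsets of a ray -/

/-- A subset of a ray `[a, ∞)` that is order-dense in it has the whole ray as derived set. -/
theorem derivedSet_eq_Ici {α : Type*} [LinearOrder α] [TopologicalSpace α] [OrderTopology α]
    [DenselyOrdered α] {a : α} (ha : ∃ b, a < b) {C : Set α} (hC : C ⊆ Set.Ici a)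
    (hd : ∀ x y, a ≤ x → x < y → ∃ c ∈ C, x < c ∧ c < y) : derivedSet C = Set.Ici a := by
  refine Set.Subset.antisymm ?_ fun x hx => ?_
  · exact (derivedSet_mono C _ hC).trans (isClosed_iff_derivedSet_subset _ |>.1 isClosed_Ici)
  · rw [mem_derivedSet, accPt_iff_nhds]
    intro U hU
    rcases eq_or_lt_of_le (Set.mem_Ici.1 hx) with rfl | hx
    · obtain ⟨u, hu, hsub⟩ := exists_Ico_subset_of_mem_nhds hU ha
      obtain ⟨c, hc, h1, h2⟩ := hd a u le_rfl hu
      exact ⟨c, ⟨hsub ⟨h1.le, h2⟩, hc⟩, h1.ne'⟩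
    · obtain ⟨u, hu, hsub⟩ := exists_Ioc_subset_of_mem_nhds hU ⟨a, hx⟩
      obtain ⟨c, hc, h1, h2⟩ := hd (max a u) x (le_max_left _ _) (max_lt hx hu)
      exact ⟨c, ⟨hsub ⟨(le_max_right _ _).trans_lt h1, h2.le⟩, hc⟩, h2.ne⟩

theorem iterate_derivedSet_eq_Ici {α : Type*} [LinearOrder α] [TopologicalSpace α]
    [OrderTopology α] [DenselyOrdered α] {a : α} (ha : ∃ b, a < b) {C : Set α}
    (hC : C ⊆ Set.Ici a) (hd : ∀ x y, a ≤ x → x < y → ∃ c ∈ C, x < c ∧ c < y) {n : ℕ}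
    (hn : 1 ≤ n) : derivedSet^[n] C = Set.Ici a := by
  induction n, hn using Nat.le_induction with
  | base => exact derivedSet_eq_Ici ha hC hd
  | succ n _ ih =>
    rw [Function.iterate_succ_apply', ih]
    refine derivedSet_eq_Ici ha subset_rfl fun x y hx hxy => ?_
    obtain ⟨c, h1, h2⟩ := exists_between hxy
    exact ⟨c, hx.trans h1.le, h1, h2⟩

/-! ### The order on infinite sequences -/

theorem isStrictTotalOrder_TGt : IsStrictTotalOrder T TGt where
  irrefl := by
    rintro k ⟨j, -, h⟩
    exact lt_irrefl _ h
  trans := by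
    rintro k m p ⟨i, hi, hi'⟩ ⟨j, hj, hj'⟩
    rcases lt_trichotomy i j with h | rfl | h
    · exact ⟨i, fun t ht => (hi t ht).trans (hj t (ht.trans h)), (hj i h) ▸ hi'⟩
    · exact ⟨i, fun t ht => (hi t ht).trans (hj t ht), hi'.trans hj'⟩
    · exact ⟨j, fun t ht => (hi t (ht.trans h)).trans (hj t ht), (hi j h) ▸ hj'⟩
  trichotomous := by
    classical
    intro k m h h'
    by_contra hne
    have hex : ∃ i, k.1 i ≠ m.1 i := by
      by_contra hcon
      push Not at hcon
      exact hne (Subtype.ext (funext hcon))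
    have hmin : ∀ i < Nat.find hex, k.1 i = m.1 i := fun i hi => not_not.1 (Nat.find_min hex hi)
    rcases lt_or_gt_of_ne (Nat.find_spec hex) with hlt | hlt
    · exact h ⟨_, hmin, hlt⟩
    · exact h' ⟨_, fun i hi => (hmin i hi).symm, hlt⟩

theorem trunc_succ (k : ℕ → ℕ) (r : ℕ) : trunc k (r + 1) = trunc k r ++ [k r] := by
  unfold trunc
  rw [List.ofFn_succ_last]
  rfl

theorem trunc_zero (k : ℕ → ℕ) : trunc k 0 = [] := rfl

theorem trunc_one (k : ℕ → ℕ) : trunc k 1 = [k 0] := rfl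

theorem length_trunc (k : ℕ → ℕ) (r : ℕ) : (trunc k r).length = r := by simp [trunc]

theorem trunc_congr {k m : ℕ → ℕ} {r : ℕ} (h : ∀ i < r, k i = m i) : trunc k r = trunc m r := by
  unfold trunc
  congr 1
  funext i
  exact h i i.2

theorem trunc_getElem? (k : ℕ → ℕ) {r i : ℕ} (hi : i < r) : (trunc k r)[i]? = some (k i) := by
  rw [List.getElem?_eq_getElem (by rwa [length_trunc])]
  simp [trunc]

theorem one_le_of_mem_trunc {k : ℕ → ℕ} (hk : ∀ i, 1 ≤ k i) (r : ℕ) : ∀ b ∈ trunc k r, 1 ≤ b := by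
  intro b hb
  obtain ⟨i, rfl⟩ := (List.mem_ofFn' _ _).1 hb
  exact hk i

theorem trunc_append {k : ℕ → ℕ} (hk : ∀ i, 1 ≤ k i) {r s : ℕ} (h : r ≤ s) :
    ∃ l, trunc k s = trunc k r ++ l ∧ ∀ b ∈ l, 1 ≤ b := by
  induction s, h using Nat.le_induction with
  | base => exact ⟨[], by simp, by simp⟩
  | succ s _ ih =>
    obtain ⟨l, h, hl⟩ := ih
    refine ⟨l ++ [k s], by rw [trunc_succ, h, List.append_assoc], fun b hb => ?_⟩
    rcases List.mem_append.1 hb with hb | hb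
    · exact hl b hb
    · rw [List.mem_singleton.1 hb]; exact hk s

theorem extendsSGt_TGt : ExtendsSGt TGt := by
  rintro k m r - (⟨l, hl, h⟩ | ⟨p, a, b, k', m', h, h', hab⟩)
  · have := congrArg List.length h
    rw [List.length_append, length_trunc, length_trunc] at this
    exact absurd (List.length_eq_zero_iff.1 (by omega)) hl
  · have hr : p.length < r := by
      have := congrArg List.length h
      rw [length_trunc] at this
      simp at this
      omega
    refine ⟨p.length, fun i hi => ?_, ?_⟩
    · have h1 := trunc_getElem? k.1 (hi.trans hr)
      have h2 := trunc_getElem? m.1 (hi.trans hr)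
      rw [h, List.getElem?_append_left hi] at h1
      rw [h', List.getElem?_append_left hi] at h2
      exact Option.some_injective _ (h1.symm.trans h2)
    · have h1 := trunc_getElem? k.1 hr
      have h2 := trunc_getElem? m.1 hr
      rw [h] at h1
      rw [h'] at h2
      simp at h1 h2
      omega

/-- `R` contains the total relation `TGt`, and a strict order cannot properly contain a strict total
order. -/
theorem eq_TGt_of_extendsSGt {R : T → T → Prop} (hR : IsStrictOrder T R) (h : ExtendsSGt R) :
    R = TGt := by
  have key : ∀ k m, TGt k m → R k m := by
    rintro k m ⟨j, hj, hlt⟩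
    refine h k m (j + 1) (by omega) (Or.inr ⟨trunc k.1 j, k.1 j, m.1 j, [], [], ?_, ?_, hlt⟩)
    · exact trunc_succ _ _
    · rw [trunc_succ, trunc_congr hj]
  funext k m
  refine propext ⟨fun hkm => ?_, key k m⟩
  by_contra hn
  have hn' : ¬TGt m k := fun hmk => hR.irrefl k (hR.trans _ _ _ hkm (key m k hmk))
  obtain rfl := isStrictTotalOrder_TGt.trichotomous k m hn hn'
  exact hR.irrefl k hkm

/-! ### The map η: finiteness and strict monotonicity -/

/-- The limit of the zeta-star values of the truncations of `k`, as an extended real. -/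
noncomputable def eta (k : ℕ → ℕ) : ENNReal := ⨆ r, nestedSup (trunc k r) one

theorem nestedSup_trunc_le_eta (k : ℕ → ℕ) (r : ℕ) : nestedSup (trunc k r) one ≤ eta k :=
  le_iSup (fun r => nestedSup (trunc k r) one) r

theorem monotone_nestedSup_trunc (k : ℕ → ℕ) : Monotone fun r => nestedSup (trunc k r) one :=
  monotone_nat_of_le_succ fun r => by
    simp only [trunc_succ]
    exact nestedSup_one_le_append _ _

theorem eta_le_nestedSup_succ {k : ℕ → ℕ} (hk : ∀ i, 1 ≤ k i) (r : ℕ) :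
    eta k ≤ nestedSup (trunc k r) succ := by
  refine iSup_le fun s => ?_
  obtain ⟨l, hl, hl'⟩ := trunc_append hk (le_max_left r s)
  calc _ ≤ nestedSup (trunc k (max r s)) one := monotone_nestedSup_trunc k (le_max_right r s)
    _ ≤ nestedSup (trunc k (max r s)) succ := nestedSup_one_le_succ _
    _ ≤ _ := by
      rw [hl]
      exact nestedSup_append_succ_le _ hl'

theorem trunc_mem_S {k : ℕ → ℕ} (hk : k ∈ T) (r : ℕ) : trunc k (r + 1) ∈ S := by
  refine ⟨k 0, List.ofFn fun i : Fin r => k (i + 1), ?_, hk.1, fun b hb => ?_⟩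
  · unfold trunc
    rw [List.ofFn_succ]
    rfl
  · obtain ⟨i, rfl⟩ := (List.mem_ofFn' _ _).1 hb
    exact hk.2.1 _

theorem append_mem_S {l : List ℕ} (hl : l ∈ S) {b : ℕ} (hb : 1 ≤ b) : l ++ [b] ∈ S := by
  obtain ⟨a, l, rfl, ha, hl⟩ := hl
  refine ⟨a, l ++ [b], rfl, ha, fun c hc => ?_⟩
  rcases List.mem_append.1 hc with hc | hc
  · exact hl c hc
  · rw [List.mem_singleton.1 hc]; exact hb

/-- Membership in `T` provides an entry that can be lowered by 1 without leaving `S`; the upper end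
at that entry is the finite lower end of the lowered sequence. -/
theorem exists_nestedSup_trunc_succ_lt_top {k : ℕ → ℕ} (hk : k ∈ T) :
    ∃ r, nestedSup (trunc k (r + 1)) succ < ⊤ := by
  obtain ⟨r, b, hb, hS⟩ : ∃ r b, k r = b + 1 ∧ trunc k r ++ [b] ∈ S := by
    rcases eq_or_lt_of_le hk.1 with h | h
    · obtain ⟨s, hs, hks⟩ := hk.2.2 h.symm
      obtain ⟨s, rfl⟩ : ∃ t, s = t + 1 := ⟨s - 1, by omega⟩
      exact ⟨s + 1, k (s + 1) - 1, by omega, append_mem_S (trunc_mem_S hk s) (by omega)⟩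
    · exact ⟨0, k 0 - 1, by omega, k 0 - 1, [], by simp [trunc_zero], by omega, by simp⟩
  refine ⟨r, ?_⟩
  rw [trunc_succ, hb, nestedSup_append_add_one_succ]
  exact nestedSup_lt_top hS

theorem eta_lt_top {k : ℕ → ℕ} (hk : k ∈ T) : eta k < ⊤ := by
  obtain ⟨r, hr⟩ := exists_nestedSup_trunc_succ_lt_top hk
  exact (eta_le_nestedSup_succ hk.2.1 (r + 1)).trans_lt hr

theorem one_lt_eta (k : ℕ → ℕ) : 1 < eta k :=
  (one_lt_nestedSup (by simp [trunc_one])).trans_le (nestedSup_trunc_le_eta k 1)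

theorem tendsto_zetaStar_trunc {k : ℕ → ℕ} (hk : k ∈ T) :
    Tendsto (fun r => zetaStar (trunc k r)) atTop (𝓝 (eta k).toReal) := by
  have h := (ENNReal.tendsto_toReal (eta_lt_top hk).ne).comp
    (tendsto_atTop_iSup (monotone_nestedSup_trunc k))
  refine h.congr' ?_
  filter_upwards [eventually_ge_atTop 1] with r hr
  obtain ⟨r, rfl⟩ : ∃ t, r = t + 1 := ⟨r - 1, by omega⟩
  obtain ⟨a, l, h, -⟩ := trunc_mem_S hk r
  simp only [Function.comp_apply, h, zetaStar_cons]

theorem eta_lt_eta {k m : T} (h : TGt k m) : eta m.1 < eta k.1 := by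
  obtain ⟨j, hj, hlt⟩ := h
  calc eta m.1 ≤ nestedSup (trunc m.1 (j + 1)) succ := eta_le_nestedSup_succ m.2.2.1 _
    _ ≤ nestedSup (trunc k.1 (j + 1)) one := by
      rw [trunc_succ, trunc_succ, ← trunc_congr hj]
      exact nestedSup_succ_le_of_lt _ hlt
    _ < nestedSup (trunc k.1 (j + 1 + 1)) one := by
      rw [trunc_succ k.1 (j + 1)]
      exact nestedSup_one_lt_append (nestedSup_lt_top (trunc_mem_S k.2 j)).ne _
    _ ≤ _ := nestedSup_trunc_le_eta _ _

theorem TGt_iff_eta_lt {k m : T} : TGt k m ↔ eta m.1 < eta k.1 := by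
  refine ⟨eta_lt_eta, fun h => ?_⟩
  by_contra hn
  have hn' : ¬TGt m k := fun hmk => (eta_lt_eta hmk).not_gt h
  obtain rfl := isStrictTotalOrder_TGt.trichotomous k m hn hn'
  exact lt_irrefl _ h

/-! ### Surjectivity of η -/

theorem exists_greedy {x : ENNReal} (hx : 1 < x) :
    ∃ k : ℕ → ℕ, (∀ i, 1 ≤ k i) ∧
      ∀ r, nestedSup (trunc k r) one < x ∧ x ≤ nestedSup (trunc k r) succ := by
  let I := {l : List ℕ // nestedSup l one < x ∧ x ≤ nestedSup l succ}
  choose c hc1 hc2 using fun l : I => exists_append_interval l.2.1 l.2.2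
  let s : ℕ → I := fun n => Nat.rec
    ⟨[], by rwa [nestedSup_nil_one], by rw [nestedSup_nil_succ]; exact le_top⟩
    (fun _ l => ⟨l.1 ++ [c l], hc2 l⟩) n
  have hs : ∀ r, trunc (fun n => c (s n)) r = (s r).1 := by
    intro r
    induction r with
    | zero => rfl
    | succ r ih => rw [trunc_succ, ih]
  refine ⟨fun n => c (s n), fun i => hc1 _, fun r => ?_⟩
  rw [hs]
  exact (s r).2

theorem not_forall_sum_le (C : ℝ) :
    ¬∀ n, ∑ m ∈ Finset.range n, 1 / ((m : ℝ) + 1) ≤ C := by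
  intro h
  obtain ⟨n, hn⟩ :=
    (Real.tendsto_sum_range_one_div_nat_succ_atTop.eventually_gt_atTop C).exists
  exact (h n).not_gt hn

theorem nested_trunc_le {k : ℕ → ℕ} {x : ℝ} (h : ∀ r, nestedSup (trunc k r) one ≤ ENNReal.ofReal x)
    (r n : ℕ) : nested (trunc k r) one n ≤ x :=
  have h' := (ofReal_nested_le _ _ n).trans (h r)
  (ENNReal.ofReal_le_ofReal_iff' .. |>.1 h').resolve_right
    (not_le.2 (zero_lt_one.trans_le (one_le_nested _ n)))

theorem nested_trunc_succ_le {k : ℕ → ℕ} (hk : ∀ i, 1 ≤ k i) {x : ℝ}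
    (h : ∀ r n, nested (trunc k r) one n ≤ x) (N : ℕ) {ε : ℝ} (hε : 0 < ε) :
    ∃ r₀, ∀ r ≥ r₀, nested (trunc k r) succ N < x + ε := by
  have hlim : Tendsto (fun r : ℕ => ((N : ℝ) / (N + 1)) ^ r * N) atTop (𝓝 (0 * N)) := by
    refine (tendsto_pow_atTop_nhds_zero_of_lt_one (by positivity) ?_).mul_const _
    rw [div_lt_one (by positivity)]
    linarith
  rw [zero_mul] at hlim
  obtain ⟨r₀, h₀⟩ := eventually_atTop.1 (hlim.eventually_lt_const hε)
  refine ⟨r₀, fun r hr => ?_⟩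
  have h1 := nested_succ_le_add (one_le_of_mem_trunc hk r) N
  rw [length_trunc] at h1
  linarith [h₀ r hr, h r N]

/-- First entry 1, or the sequence 2, 1, 1, …, would bound the harmonic sums: directly in the first
case, through the `succ` sums, all equal to `nested [1] one`, in the second. -/
theorem mem_T_of_nested_le {k : ℕ → ℕ} (hk : ∀ i, 1 ≤ k i) {x : ℝ}
    (h : ∀ r n, nested (trunc k r) one n ≤ x) : k ∈ T := by
  refine ⟨?_, hk, fun h0 => ?_⟩
  · by_contra hlt
    have h0 : k 0 = 1 := by have := hk 0; omega
    refine not_forall_sum_le x fun n => ?_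
    have := h 1 n
    rw [trunc_one, h0, nested_cons, Finset.sum_range_succ] at this
    simp only [nested_nil, one, pow_one] at this
    have : 0 ≤ 1 / ((n : ℝ) + 1) := by positivity
    linarith
  · by_contra hcon
    push Not at hcon
    have hsucc : ∀ r, nested (trunc k (r + 1)) succ = nested [1] one := by
      intro r
      induction r with
      | zero => rw [zero_add, trunc_one, h0, nested_singleton_add_one_succ]
      | succ r ih =>
        have : k (r + 1) = 1 := by have := hk (r + 1); have := hcon (r + 1) (by omega); omega
        rw [trunc_succ, nested_append, this, funext nested_singleton_one_succ]
        exact ih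
    refine not_forall_sum_le (x + 1) fun n => ?_
    obtain ⟨r₀, hr⟩ := nested_trunc_succ_le hk h n one_pos
    have := hr (r₀ + 1) (by omega)
    rw [hsucc, nested_cons, Finset.sum_range_succ] at this
    simp only [nested_nil, one, pow_one] at this
    have : 0 ≤ 1 / ((n : ℝ) + 1) := by positivity
    linarith

theorem nested_trunc_sub_le {k : ℕ → ℕ} (hk : ∀ i, 1 ≤ k i) {r s : ℕ} (hrs : r ≤ s) {N M : ℕ}
    (hNM : N ≤ M) :
    nested (trunc k (s + 1)) succ M - nested (trunc k (s + 1)) succ N ≤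
      nested (trunc k (r + 1)) succ M - nested (trunc k (r + 1)) succ N := by
  obtain ⟨l, hl, hl'⟩ := trunc_append hk (Nat.succ_le_succ hrs)
  have e : trunc k (r + 1) = k 0 :: List.ofFn fun i : Fin r => k (i + 1) := by
    unfold trunc
    rw [List.ofFn_succ]
    rfl
  simp only [Nat.succ_eq_add_one] at hl
  rw [hl, nested_append, e]
  exact nested_sub_le (nested_succ_le hl') hNM

/-- Exchange of the limits in r and in the bound. N is chosen so that the `succ` tail beyond N is
below ε/2 at one length; longer truncations have smaller tails, and at bound N their `succ` sums
eventually drop below y + ε/2. -/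
theorem le_of_le_nestedSup_succ {k : ℕ → ℕ} (hk : k ∈ T) {x y : ℝ} (hy : 0 ≤ y)
    (h : ∀ r n, nested (trunc k r) one n ≤ y)
    (hx : ∀ r, ENNReal.ofReal x ≤ nestedSup (trunc k r) succ) : x ≤ y := by
  refine le_of_forall_pos_le_add fun ε hε => ?_
  obtain ⟨r₀, hr₀⟩ := exists_nestedSup_trunc_succ_lt_top hk
  set B := nestedSup (trunc k (r₀ + 1)) succ with hB
  have hle : ∀ M, nested (trunc k (r₀ + 1)) succ M ≤ B.toReal := fun M =>
    (ENNReal.ofReal_le_iff_le_toReal hr₀.ne).1 (ofReal_nested_le _ _ M)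
  obtain ⟨N, hN⟩ : ∃ N, B.toReal - ε / 2 < nested (trunc k (r₀ + 1)) succ N := by
    by_contra hcon
    push Not at hcon
    have hpos : 0 ≤ B.toReal - ε / 2 := (nested_nonneg _ succ_nonneg 0).trans (hcon 0)
    have : B ≤ ENNReal.ofReal (B.toReal - ε / 2) :=
      iSup_le fun n => ENNReal.ofReal_le_ofReal (hcon n)
    have := ENNReal.toReal_le_of_le_ofReal hpos this
    linarith
  obtain ⟨r₁, hr₁⟩ := nested_trunc_succ_le hk.2.1 h N (half_pos hε)
  have hmax := hr₁ (max r₀ r₁ + 1) (by omega)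
  have hbound : ∀ M, nested (trunc k (max r₀ r₁ + 1)) succ M ≤ y + ε := by
    intro M
    refine (monotone_nested _ succ_nonneg monotone_succ (le_max_right N M)).trans ?_
    have := nested_trunc_sub_le hk.2.1 (le_max_left r₀ r₁) (le_max_left N M)
    linarith [hle (max N M)]
  have := (hx (max r₀ r₁ + 1)).trans (iSup_le fun n => ENNReal.ofReal_le_ofReal (hbound n))
  exact (ENNReal.ofReal_le_ofReal_iff (by positivity)).1 this

theorem exists_eta_eq {x : ℝ} (hx : 1 < x) : ∃ k ∈ T, (eta k).toReal = x := by
  obtain ⟨k, hk, h⟩ := exists_greedy (x := ENNReal.ofReal x) (by simpa using hx)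
  have hx0 : 0 ≤ x := by linarith
  have hT : k ∈ T := mem_T_of_nested_le hk (nested_trunc_le fun r => (h r).1.le)
  refine ⟨k, hT, le_antisymm ?_ ?_⟩
  · exact ENNReal.toReal_le_of_le_ofReal hx0 (iSup_le fun r => (h r).1.le)
  · refine le_of_le_nestedSup_succ hT ENNReal.toReal_nonneg (nested_trunc_le fun r => ?_)
      fun r => (h r).2
    rw [ENNReal.ofReal_toReal (eta_lt_top hT).ne]
    exact nestedSup_trunc_le_eta k r

/-! ### Density of the zeta-star values -/

theorem exists_mem_Z_between {x y : ℝ} (hx : 1 ≤ x) (hxy : x < y) : ∃ c ∈ Z, x < c ∧ c < y := by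
  obtain ⟨z, hxz, hzy⟩ := exists_between hxy
  obtain ⟨k, hk, rfl⟩ := exists_eta_eq (hx.trans_lt hxz)
  have hlim := (tendsto_zetaStar_trunc hk).eventually (Ioo_mem_nhds hxz hzy)
  obtain ⟨r, hr, hr1⟩ := (hlim.and (eventually_ge_atTop 1)).exists
  obtain ⟨r, rfl⟩ : ∃ t, r = t + 1 := ⟨r - 1, by omega⟩
  exact ⟨_, ⟨_, trunc_mem_S hk r, rfl⟩, hr⟩

theorem Z_subset_Ioi : Z ⊆ Set.Ioi 1 := by
  rintro _ ⟨l, hl, rfl⟩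
  exact one_lt_zetaStar hl

theorem exists_mem_image_Z_between {x y : EReal} (hx : 1 ≤ x) (hxy : x < y) :
    ∃ c ∈ (fun x : ℝ => (x : EReal)) '' Z, x < c ∧ c < y := by
  obtain ⟨a, hxa, hay⟩ := EReal.lt_iff_exists_real_btwn.1 hxy
  obtain ⟨b, hab, hby⟩ := EReal.lt_iff_exists_real_btwn.1 hay
  have h1 : (1 : ℝ) ≤ a := by exact_mod_cast hx.trans hxa.le
  obtain ⟨c, hc, hac, hcb⟩ := exists_mem_Z_between h1 (EReal.coe_lt_coe_iff.1 hab)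
  exact ⟨c, ⟨c, hc, rfl⟩, hxa.trans (EReal.coe_lt_coe_iff.2 hac),
    (EReal.coe_lt_coe_iff.2 hcb).trans hby⟩

end ZetaStar

theorem theorem1p3 :
    -- the order of `𝒮` extends to a strict total order `≻` on `𝒯`, in exactly one way
    (IsStrictTotalOrder ZetaStar.T ZetaStar.TGt ∧ ZetaStar.ExtendsSGt ZetaStar.TGt ∧
      ∀ R : ZetaStar.T → ZetaStar.T → Prop,
        IsStrictOrder ZetaStar.T R → ZetaStar.ExtendsSGt R → R = ZetaStar.TGt) ∧
    -- the limits exist, exceed 1, and define an order-preserving bijection `η : 𝒯 → (1, ∞)`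
    (∃ η : ZetaStar.T → Set.Ioi (1 : ℝ),
      (∀ k : ZetaStar.T,
        Tendsto (fun r : ℕ => ZetaStar.zetaStar (ZetaStar.trunc k.1 r)) atTop (𝓝 (η k : ℝ))) ∧
      Function.Bijective η ∧
      ∀ k m : ZetaStar.T, ZetaStar.TGt k m ↔ (η k : ℝ) > (η m : ℝ)) ∧
    -- all derived sets of `𝒵⋆`, in the extended real line and in the real line
    (∀ n : ℕ, 1 ≤ n →
      derivedSet^[n] ((fun x : ℝ => (x : EReal)) '' ZetaStar.Z) = Set.Icc (1 : EReal) ⊤ ∧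
      derivedSet^[n] ZetaStar.Z = Set.Ici (1 : ℝ)) ∧
    -- `𝒵⋆` is a dense subset of `(1, ∞)`
    (ZetaStar.Z ⊆ Set.Ioi 1 ∧ Set.Ioi 1 ⊆ closure ZetaStar.Z) := by
  have hη (k : ZetaStar.T) : 1 < (ZetaStar.eta k.1).toReal := by
    simpa using ENNReal.toReal_strict_mono (ZetaStar.eta_lt_top k.2).ne (ZetaStar.one_lt_eta k.1)
  have hlt (k m : ZetaStar.T) :
      ZetaStar.TGt k m ↔ (ZetaStar.eta k.1).toReal > (ZetaStar.eta m.1).toReal := by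
    rw [ZetaStar.TGt_iff_eta_lt, gt_iff_lt, ENNReal.toReal_lt_toReal
      (ZetaStar.eta_lt_top m.2).ne (ZetaStar.eta_lt_top k.2).ne]
  refine ⟨⟨ZetaStar.isStrictTotalOrder_TGt, ZetaStar.extendsSGt_TGt,
      fun R => ZetaStar.eq_TGt_of_extendsSGt⟩,
    ⟨fun k => ⟨(ZetaStar.eta k.1).toReal, hη k⟩,
      fun k => ZetaStar.tendsto_zetaStar_trunc k.2, ⟨fun k m h => ?_, ?_⟩, hlt⟩,
    fun n hn => ⟨?_, ?_⟩, ZetaStar.Z_subset_Ioi, fun x hx => ?_⟩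
  · have h' := congrArg Subtype.val h
    exact ZetaStar.isStrictTotalOrder_TGt.trichotomous k m
      (fun hkm => ((hlt k m).1 hkm).ne' h') (fun hmk => ((hlt m k).1 hmk).ne h')
  · rintro ⟨x, hx⟩
    obtain ⟨k, hk, hkx⟩ := ZetaStar.exists_eta_eq hx
    exact ⟨⟨k, hk⟩, Subtype.ext hkx⟩
  · rw [Set.Icc_top]
    refine ZetaStar.iterate_derivedSet_eq_Ici ⟨⊤, by simpa using EReal.coe_lt_top 1⟩ ?_
      (fun x y => ZetaStar.exists_mem_image_Z_between) hn
    rintro _ ⟨x, hx, rfl⟩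
    have : (1 : ℝ) < x := ZetaStar.Z_subset_Ioi hx
    exact EReal.coe_le_coe_iff.2 this.le
  · exact ZetaStar.iterate_derivedSet_eq_Ici ⟨2, by norm_num⟩
      (ZetaStar.Z_subset_Ioi.trans Set.Ioi_subset_Ici_self)
      (fun x y => ZetaStar.exists_mem_Z_between) hn
  · refine mem_closure_iff_nhds.2 fun U hU => ?_
    obtain ⟨u, hu, hsub⟩ := exists_Ico_subset_of_mem_nhds hU ⟨x + 1, by linarith⟩
    obtain ⟨c, hc, h1, h2⟩ := ZetaStar.exists_mem_Z_between (le_of_lt hx) hu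
    exact ⟨c, hsub ⟨h1.le, h2⟩, hc⟩
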